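/- Let $I\subseteq\mathbb R$ be an open interval, and let $D,H:I\to\mathbb R$ be smooth functions with $D(r)\neq 0$ for all $r\in I$. Let $M=\{(t,r,\varphi)\in\mathbb R^3 : r\in I\}$ carry the three-dimensional Gödel-like Lorentzian metric $$g=-\bigl(dt+H(r)\,d\varphi\bigr)^2+D(r)^2\,d\varphi^2+dr^2 .$$ Suppose that $(M,g)$ is of P-type O, that is, its Ricci tensor has Segre type $[(11,1)]$ at every point: at each $x\in M$ there is a $g$-orthonormal frame, consisting of one timelike and two spacelike vectors, of eigenvectors of the Ricci operator $\mathrm{Ric}^a{}_b$, all three with the same eigenvalue (which is allowed to depend on $x$). Then: 1. the covariant derivative of the Ricci tensor with respect to the Levi-Civita connection of $g$ vanishes on $M$, i.e. $\nabla_c R_{ab}=0$; 2. $(M,g)$ is locally homogeneous: for all $p,q\in M$ there are open sets $U\ni p$ and $V\ni q$ in $M$ and a smooth isometry $f:(U,g|_U)\to(V,g|_V)$ (a diffeomorphism with smooth inverse and $f^*g=g$) with $f(p)=q$. -/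

import Mathlib

open scoped ContDiff

noncomputable section

namespace GodelLike

/-- Coordinate space `ℝ³`; the coordinates are `x 0 = t`, `x 1 = r`, `x 2 = φ`. -/
abbrev Coord : Type := Fin 3 → ℝ

/-- A field of `3 × 3` matrices on coordinate space: the components, in the coordinate basis,
of a covariant 2-tensor field. -/
abbrev Tensor2 : Type := Coord → Matrix (Fin 3) (Fin 3) ℝ

/-- The partial derivative `∂ᵢ f` at `x`. -/
def pderiv (i : Fin 3) (f : Coord → ℝ) (x : Coord) : ℝ :=
  fderiv ℝ f x (Pi.single i 1)

/-- The bilinear form with components `T x`: `T x (v, w) = ∑ᵢⱼ Tᵢⱼ(x) vⁱ wʲ`. -/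
def bil (T : Tensor2) (x v w : Coord) : ℝ :=
  ∑ i, ∑ j, T x i j * v i * w j

/-- Christoffel symbols of the Levi-Civita connection,
`Γᵏᵢⱼ = ½ ∑ₗ gᵏˡ (∂ᵢ gₗⱼ + ∂ⱼ gₗᵢ - ∂ₗ gᵢⱼ)`. -/
def christoffel (g : Tensor2) (k i j : Fin 3) (x : Coord) : ℝ :=
  (1 / 2 : ℝ) * ∑ l, (g x)⁻¹ k l *
    (pderiv i (fun y => g y l j) x + pderiv j (fun y => g y l i) x
      - pderiv l (fun y => g y i j) x)

/-- The Riemann curvature tensor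
`Rˡₖᵢⱼ = ∂ᵢ Γˡⱼₖ - ∂ⱼ Γˡᵢₖ + ∑ₘ (Γˡᵢₘ Γᵐⱼₖ - Γˡⱼₘ Γᵐᵢₖ)`. -/
def riemann (g : Tensor2) (l k i j : Fin 3) (x : Coord) : ℝ :=
  pderiv i (christoffel g l j k) x - pderiv j (christoffel g l i k) x
    + ∑ m, (christoffel g l i m x * christoffel g m j k x
      - christoffel g l j m x * christoffel g m i k x)

/-- The Ricci tensor `Rₐᵦ = ∑ᵢ Rⁱₐᵢᵦ`. -/
def ricci (g : Tensor2) : Tensor2 :=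
  fun x => Matrix.of fun a b => ∑ i, riemann g i a i b x

/-- The components `∇_c T_{ab} = ∂_c T_{ab} - ∑_d (T_{db} Γᵈ_{ca} + T_{ad} Γᵈ_{cb})` of the
Levi-Civita covariant derivative of a covariant 2-tensor field. -/
def covDeriv (g T : Tensor2) (c a b : Fin 3) (x : Coord) : ℝ :=
  pderiv c (fun y => T y a b) x
    - ∑ d, (T x d b * christoffel g d c a x + T x a d * christoffel g d c b x)

/-- At `x` the tensor `T` is of Segre type `[(11,1)]` with respect to the Lorentzian metric `g`:
there are two spacelike and one timelike eigenvectors, forming a `g`-orthonormal frame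
(`e 0` timelike, `e 1` and `e 2` spacelike), and the three eigenvalues coincide. That `e i` is an
eigenvector of `T` with index raised is written with the index lowered:
`T(e i, ·) = lam g(e i, ·)`. -/
def IsSegre11c1 (g T : Tensor2) (x : Coord) : Prop :=
  ∃ (e : Fin 3 → Coord) (lam : ℝ),
    (∀ i j, bil g x (e i) (e j) = if i = j then (if i = 0 then -1 else 1) else 0) ∧
    ∀ i, ∀ w, bil T x (e i) w = lam * bil g x (e i) w

/-- P-type O on the region `M`: the Ricci tensor is of Segre type `[(11,1)]` at every point.
The eigenvalue may a priori depend on the point. -/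
def IsPTypeO (g : Tensor2) (M : Set Coord) : Prop :=
  ∀ x ∈ M, IsSegre11c1 g (ricci g) x

/-- `f` is a smooth isometry from an open subset of `M` onto an open subset of `M`, both carrying
the metric `g`. -/
structure IsLocalIsometry (g : Tensor2) (M : Set Coord)
    (f : OpenPartialHomeomorph Coord Coord) : Prop where
  source_subset : f.source ⊆ M
  target_subset : f.target ⊆ M
  smooth : ContDiffOn ℝ ∞ f f.source
  smooth_symm : ContDiffOn ℝ ∞ f.symm f.target
  isometry : ∀ x ∈ f.source, ∀ v w,
    bil g (f x) (fderiv ℝ f x v) (fderiv ℝ f x w) = bil g x v w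

/-- `(M, g)` is locally homogeneous: any point can be taken to any other point by an isometry
from a neighbourhood of the one onto a neighbourhood of the other. -/
def IsLocallyHomogeneous (g : Tensor2) (M : Set Coord) : Prop :=
  ∀ p ∈ M, ∀ q ∈ M, ∃ f : OpenPartialHomeomorph Coord Coord,
    IsLocalIsometry g M f ∧ p ∈ f.source ∧ f p = q

/-- The coordinate domain `{(t, r, φ) : r ∈ I}`. -/
def domain (I : Set ℝ) : Set Coord := {x | x 1 ∈ I}

/-- The Gödel-like metric `ds² = -(dt + H(r) dφ)² + D(r)² dφ² + dr²`. -/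
def metric (D H : ℝ → ℝ) : Tensor2 := fun x =>
  !![-1, 0, -H (x 1);
     0, 1, 0;
     -H (x 1), 0, D (x 1) ^ 2 - H (x 1) ^ 2]

/-- The matrix above is the one of the displayed line element. -/
theorem bil_metric_self (D H : ℝ → ℝ) (x v : Coord) :
    bil (metric D H) x v v =
      -(v 0 + H (x 1) * v 2) ^ 2 + D (x 1) ^ 2 * v 2 ^ 2 + v 1 ^ 2 := by
  simp [bil, metric, Fin.sum_univ_three]
  ring

/-- The matrix of the metric is symmetric. -/
theorem metric_isSymm (D H : ℝ → ℝ) (x : Coord) : (metric D H x).IsSymm := by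
  ext i j
  fin_cases i <;> fin_cases j <;> simp [metric]

end GodelLike

end

namespace GodelLike

open Filter Topology

/-! Type `[(11,1)]` forces Ric = λ g at each point (`IsSegre11c1.exists_smul`). For this metric the
equation gives λ = -H'²/(2D²), D''D = H'² and H''D = H'D' (`field_equations`). The last one says
that k = H'/D has zero derivative, so it is constant on the interval; then D'' = k²D and λ = -k²/2.
As λ is constant, ∇Ric = λ∇g = 0.

The equations for D and H can then be solved. If k = 0, D is affine, H is constant and g is flat. If
k ≠ 0, D and H - c₀ are combinations of exp(±kr), and g is locally the bi-invariant metric of SL₂(ℝ)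
scaled by k. The model depends on k alone, and around every point p there is an explicit chart
taking p to one fixed base point (`exists_flat_chart`, `exists_sl_chart`). Following the chart at p
by the inverse of the chart at q gives the isometry, so no isometry group of the model is needed. -/

/-! ### Connection and Ricci tensor in coordinates -/

/-- The partial derivatives of a function of the coordinate `r` alone. -/
theorem pderiv_comp_r {F : ℝ → ℝ} {F' : ℝ} {x : Coord} (h : HasDerivAt F F' (x 1)) (i : Fin 3) :
    pderiv i (fun y => F (y 1)) x = if i = 1 then F' else 0 := by
  have h1 : HasFDerivAt (fun y : Coord => y 1)
      (ContinuousLinearMap.proj (R := ℝ) (φ := fun _ : Fin 3 => ℝ) 1) x :=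
    (ContinuousLinearMap.proj (R := ℝ) (φ := fun _ : Fin 3 => ℝ) 1).hasFDerivAt
  have h2 := h.comp_hasFDerivAt x h1
  have h3 : pderiv i (fun y => F (y 1)) x = _ :=
    congrArg (fun L : Coord →L[ℝ] ℝ => L (Pi.single i 1)) h2.fderiv
  rw [h3]
  by_cases hi : i = 1
  · subst hi; simp
  · simp [hi, eq_comm]

theorem pderiv_congr {f g : Coord → ℝ} {x : Coord} (h : f =ᶠ[𝓝 x] g) (i : Fin 3) :
    pderiv i f x = pderiv i g x := by
  unfold pderiv
  rw [h.fderiv_eq]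

theorem isOpen_domain {I : Set ℝ} (hI : IsOpen I) : IsOpen (domain I) :=
  hI.preimage (continuous_apply (1 : Fin 3))

theorem metric_inv {D H : ℝ → ℝ} {x : Coord} (h : D (x 1) ≠ 0) :
    (metric D H x)⁻¹ = !![-1 + H (x 1) ^ 2 / D (x 1) ^ 2, 0, -H (x 1) / D (x 1) ^ 2;
      0, 1, 0; -H (x 1) / D (x 1) ^ 2, 0, 1 / D (x 1) ^ 2] := by
  apply Matrix.inv_eq_right_inv
  ext i j
  fin_cases i <;> fin_cases j <;> simp [metric, Matrix.mul_apply, Fin.sum_univ_three] <;>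
    field_simp <;> ring

/-- The components `Γᵏᵢⱼ` of the Levi-Civita connection of the Gödel-like metric, in terms of the
values `d, d', h, h'` of `D`, `D'`, `H`, `H'`. -/
noncomputable def gam (d d' h h' : ℝ) (k : Fin 3) : Matrix (Fin 3) (Fin 3) ℝ :=
  ![!![0, h * h' / (2 * d ^ 2), 0;
       h * h' / (2 * d ^ 2), 0, h' / 2 + h ^ 2 * h' / (2 * d ^ 2) - h * d' / d;
       0, h' / 2 + h ^ 2 * h' / (2 * d ^ 2) - h * d' / d, 0],
    !![0, 0, h' / 2; 0, 0, 0; h' / 2, 0, h * h' - d * d'],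
    !![0, -h' / (2 * d ^ 2), 0;
       -h' / (2 * d ^ 2), 0, d' / d - h * h' / (2 * d ^ 2);
       0, d' / d - h * h' / (2 * d ^ 2), 0]] k

/-- The partial derivatives of the components of the Gödel-like metric. -/
theorem pderiv_metric {D H : ℝ → ℝ} {d' h' : ℝ} {x : Coord}
    (hD : HasDerivAt D d' (x 1)) (hH : HasDerivAt H h' (x 1)) (i j k : Fin 3) :
    pderiv k (fun y => metric D H y i j) x = if k = 1 then
      !![0, 0, -h'; 0, 0, 0; -h', 0, 2 * D (x 1) * d' - 2 * H (x 1) * h'] i j else 0 := by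
  have hc : ∀ a : ℝ, HasDerivAt (fun _ : ℝ => a) 0 (x 1) := fun a => hasDerivAt_const _ a
  have hF : HasDerivAt (fun r => !![-1, 0, -H r; 0, 1, 0; -H r, 0, D r ^ 2 - H r ^ 2] i j)
      (!![0, 0, -h'; 0, 0, 0; -h', 0, 2 * D (x 1) * d' - 2 * H (x 1) * h'] i j) (x 1) := by
    have h1 : HasDerivAt (fun r => D r ^ 2 - H r ^ 2) (2 * D (x 1) * d' - 2 * H (x 1) * h') (x 1) :=
      ((hD.fun_pow 2).fun_sub (hH.fun_pow 2)).congr_deriv (by simp)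
    fin_cases i <;> fin_cases j <;> first | exact hc _ | exact hH.neg | exact h1
  exact pderiv_comp_r hF k

theorem christoffel_metric {D H : ℝ → ℝ} {d' h' : ℝ} {x : Coord}
    (hD : HasDerivAt D d' (x 1)) (hH : HasDerivAt H h' (x 1)) (h0 : D (x 1) ≠ 0)
    (k i j : Fin 3) :
    christoffel (metric D H) k i j x = gam (D (x 1)) d' (H (x 1)) h' k i j := by
  simp only [christoffel, pderiv_metric hD hH, metric_inv h0]
  fin_cases k <;> fin_cases i <;> fin_cases j <;> simp [gam, Fin.sum_univ_three] <;>
    field_simp <;> ring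

/-- The derivative of `gam` along functions `D, D', H, H'` of `r`. -/
noncomputable def dgam (d d' d'' h h' h'' : ℝ) (k : Fin 3) : Matrix (Fin 3) (Fin 3) ℝ :=
  let a := (h' ^ 2 + h * h'') / (2 * d ^ 2) - h * h' * d' / d ^ 3
  let b := h'' / 2 + (2 * h * h' ^ 2 + h ^ 2 * h'') / (2 * d ^ 2) - h ^ 2 * h' * d' / d ^ 3
    - (h' * d' + h * d'') / d + h * d' ^ 2 / d ^ 2
  let c := -h'' / (2 * d ^ 2) + h' * d' / d ^ 3
  let e := d'' / d - d' ^ 2 / d ^ 2 - a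
  ![!![0, a, 0; a, 0, b; 0, b, 0],
    !![0, 0, h'' / 2; 0, 0, 0; h'' / 2, 0, h' ^ 2 + h * h'' - d' ^ 2 - d * d''],
    !![0, c, 0; c, 0, e; 0, e, 0]] k

theorem hasDerivAt_gam {D D' H H' : ℝ → ℝ} {d'' h'' r : ℝ}
    (hD : HasDerivAt D (D' r) r) (hD' : HasDerivAt D' d'' r)
    (hH : HasDerivAt H (H' r) r) (hH' : HasDerivAt H' h'' r) (h0 : D r ≠ 0) (k i j : Fin 3) :
    HasDerivAt (fun r => gam (D r) (D' r) (H r) (H' r) k i j)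
      (dgam (D r) (D' r) d'' (H r) (H' r) h'' k i j) r := by
  have hc : ∀ a : ℝ, HasDerivAt (fun _ : ℝ => a) 0 r := fun a => hasDerivAt_const _ a
  have h2 : HasDerivAt (fun r => 2 * D r ^ 2) (4 * D r * D' r) r :=
    ((hD.pow 2).const_mul 2).congr_deriv (by simp; ring)
  have h02 : 2 * D r ^ 2 ≠ 0 := by positivity
  have h3 : HasDerivAt (fun r => H r * H' r / (2 * D r ^ 2))
      ((H' r ^ 2 + H r * h'') / (2 * D r ^ 2) - H r * H' r * D' r / D r ^ 3) r :=
    ((hH.mul hH').fun_div h2 h02).congr_deriv (by simp only [Pi.mul_apply]; field_simp; ring)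
  have h4 : HasDerivAt (fun r => D' r / D r) (d'' / D r - D' r ^ 2 / D r ^ 2) r :=
    (hD'.fun_div hD h0).congr_deriv (by field_simp)
  have h6 := (hH.fun_mul hD').fun_div hD h0
  have h7 := hH'.fun_neg.fun_div h2 h02
  have h8 := h4.fun_sub h3
  have h9 := hH'.div_const 2
  have h10 := (hH.fun_mul hH').fun_sub (hD.fun_mul hD')
  have h11 : HasDerivAt
      (fun r => H' r / 2 + H r ^ 2 * H' r / (2 * D r ^ 2) - H r * D' r / D r)
      (h'' / 2 + (2 * H r * H' r ^ 2 + H r ^ 2 * h'') / (2 * D r ^ 2)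
        - H r ^ 2 * H' r * D' r / D r ^ 3 - (H' r * D' r + H r * d'') / D r
        + H r * D' r ^ 2 / D r ^ 2) r :=
    ((h9.fun_add (((hH.fun_pow 2).fun_mul hH').fun_div h2 h02)).fun_sub h6).congr_deriv
      (by simp; field_simp; ring)
  have h12 : HasDerivAt (fun r => -H' r / (2 * D r ^ 2))
      (-h'' / (2 * D r ^ 2) + H' r * D' r / D r ^ 3) r :=
    h7.congr_deriv (by field_simp; ring)
  have h13 : HasDerivAt (fun r => H r * H' r - D r * D' r)
      (H' r ^ 2 + H r * h'' - D' r ^ 2 - D r * d'') r :=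
    h10.congr_deriv (by ring)
  fin_cases k <;> fin_cases i <;> fin_cases j <;> simp only [gam, dgam, Fin.zero_eta, Fin.mk_one,
      Fin.reduceFinMk, Matrix.of_apply, Matrix.cons_val', Matrix.cons_val_zero,
      Matrix.cons_val_one, Matrix.cons_val] <;> first
    | exact hc _ | exact h9 | exact h3 | exact h8 | exact h11 | exact h12 | exact h13

/-- The functions `D` and `H` have second derivatives on the open set `I`, and `D` has no zero
there. -/
structure Profile (I : Set ℝ) (D D' D'' H H' H'' : ℝ → ℝ) : Prop where
  isOpen : IsOpen I
  hasDerivAt_D : ∀ r ∈ I, HasDerivAt D (D' r) r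
  hasDerivAt_D' : ∀ r ∈ I, HasDerivAt D' (D'' r) r
  hasDerivAt_H : ∀ r ∈ I, HasDerivAt H (H' r) r
  hasDerivAt_H' : ∀ r ∈ I, HasDerivAt H' (H'' r) r
  ne_zero : ∀ r ∈ I, D r ≠ 0

namespace Profile

variable {I : Set ℝ} {D D' D'' H H' H'' : ℝ → ℝ}

theorem christoffel_eq (P : Profile I D D' D'' H H' H'') {x : Coord} (hx : x ∈ domain I)
    (k i j : Fin 3) : christoffel (metric D H) k i j x =
      gam (D (x 1)) (D' (x 1)) (H (x 1)) (H' (x 1)) k i j :=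
  christoffel_metric (P.hasDerivAt_D _ hx) (P.hasDerivAt_H _ hx) (P.ne_zero _ hx) k i j

theorem pderiv_christoffel (P : Profile I D D' D'' H H' H'') {x : Coord} (hx : x ∈ domain I)
    (k i j l : Fin 3) : pderiv l (christoffel (metric D H) k i j) x = if l = 1 then
      dgam (D (x 1)) (D' (x 1)) (D'' (x 1)) (H (x 1)) (H' (x 1)) (H'' (x 1)) k i j else 0 := by
  have h : christoffel (metric D H) k i j =ᶠ[𝓝 x]
      fun y => gam (D (y 1)) (D' (y 1)) (H (y 1)) (H' (y 1)) k i j := by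
    filter_upwards [(isOpen_domain P.isOpen).mem_nhds hx] with y hy using P.christoffel_eq hy k i j
  rw [pderiv_congr h]
  exact pderiv_comp_r (F := fun r => gam (D r) (D' r) (H r) (H' r) k i j)
    (hasDerivAt_gam (P.hasDerivAt_D _ hx) (P.hasDerivAt_D' _ hx) (P.hasDerivAt_H _ hx)
      (P.hasDerivAt_H' _ hx) (P.ne_zero _ hx) k i j) l

/-- The components 00, 11 and 02 suffice: equated with those of λ g, they determine λ and both field
equations. -/
theorem ricci_zero_zero (P : Profile I D D' D'' H H' H'') {x : Coord} (hx : x ∈ domain I) :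
    ricci (metric D H) x 0 0 = H' (x 1) ^ 2 / (2 * D (x 1) ^ 2) := by
  have h0 := P.ne_zero _ hx
  simp only [ricci, riemann, Matrix.of_apply, P.pderiv_christoffel hx, P.christoffel_eq hx,
    Fin.sum_univ_three]
  simp [gam, dgam]
  field_simp
  ring

theorem ricci_one_one (P : Profile I D D' D'' H H' H'') {x : Coord} (hx : x ∈ domain I) :
    ricci (metric D H) x 1 1 = H' (x 1) ^ 2 / (2 * D (x 1) ^ 2) - D'' (x 1) / D (x 1) := by
  have h0 := P.ne_zero _ hx
  simp only [ricci, riemann, Matrix.of_apply, P.pderiv_christoffel hx, P.christoffel_eq hx,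
    Fin.sum_univ_three]
  simp [gam, dgam]
  field_simp
  ring

theorem ricci_zero_two (P : Profile I D D' D'' H H' H'') {x : Coord} (hx : x ∈ domain I) :
    ricci (metric D H) x 0 2 = H (x 1) * H' (x 1) ^ 2 / (2 * D (x 1) ^ 2) +
      (H'' (x 1) - H' (x 1) * D' (x 1) / D (x 1)) / 2 := by
  have h0 := P.ne_zero _ hx
  simp only [ricci, riemann, Matrix.of_apply, P.pderiv_christoffel hx, P.christoffel_eq hx,
    Fin.sum_univ_three]
  simp [gam, dgam]
  field_simp
  ring

/-- Metric compatibility of the Levi-Civita connection. -/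
theorem covDeriv_const_smul (P : Profile I D D' D'' H H' H'') {x : Coord} (hx : x ∈ domain I)
    {T : Tensor2} (lam : ℝ) (hT : ∀ y ∈ domain I, T y = lam • metric D H y) (c a b : Fin 3) :
    covDeriv (metric D H) T c a b x = 0 := by
  have h0 := P.ne_zero _ hx
  have h : (fun y => T y a b) =ᶠ[𝓝 x] fun y => lam * metric D H y a b := by
    filter_upwards [(isOpen_domain P.isOpen).mem_nhds hx] with y hy
    simp [hT y hy]
  have h1 : pderiv c (fun y => lam * metric D H y a b) x =
      lam * pderiv c (fun y => metric D H y a b) x := by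
    have h2 : (fun y => lam * metric D H y a b) = lam • fun y => metric D H y a b := rfl
    rw [h2]
    simp [pderiv, fderiv_const_smul_field]
  rw [covDeriv, pderiv_congr h, h1, pderiv_metric (P.hasDerivAt_D _ hx) (P.hasDerivAt_H _ hx)]
  simp only [P.christoffel_eq hx, hT x hx, Fin.sum_univ_three]
  fin_cases c <;> fin_cases a <;> fin_cases b <;> simp [gam, metric] <;>
    field_simp <;> ring

end Profile

/-! ### Algebra of the Segre type -/

/-- A tensor of Segre type `[(11,1)]` is a multiple of the metric. -/
theorem IsSegre11c1.exists_smul {g T : Tensor2} {x : Coord} (h : IsSegre11c1 g T x) :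
    ∃ lam : ℝ, T x = lam • g x := by
  obtain ⟨e, lam, he, hT⟩ := h
  refine ⟨lam, ?_⟩
  set E : Matrix (Fin 3) (Fin 3) ℝ := Matrix.of e
  have hbil : ∀ (S : Tensor2) (v w : Coord), bil S x v w = v ⬝ᵥ (S x).mulVec w := by
    intro S v w
    simp only [bil, dotProduct, Matrix.mulVec, Finset.mul_sum]
    exact Finset.sum_congr rfl fun i _ => Finset.sum_congr rfl fun j _ => by ring
  -- The rows of `E` are the frame vectors. Orthonormality makes `E` invertible, and the eigenvector
  -- equations read E T = λ E g, from which `E` cancels.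
  have h1 : E * (g x * E.transpose) = Matrix.diagonal ![-1, 1, 1] := by
    ext i j
    have h2 : (E * (g x * E.transpose)) i j = bil g x (e i) (e j) := by
      rw [hbil]; rfl
    rw [h2, he]
    fin_cases i <;> fin_cases j <;> simp
  have hdet : IsUnit E.det := by
    have h2 := congrArg Matrix.det h1
    rw [Matrix.det_mul, Matrix.det_diagonal, Fin.prod_univ_three] at h2
    refine isUnit_iff_ne_zero.2 fun h0 => ?_
    simp [h0] at h2
  have h3 : E * T x = E * (lam • g x) := by
    ext i j
    have h4 := hT i (Pi.single j 1)
    rw [hbil, hbil] at h4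
    simp only [Matrix.mulVec_single_one] at h4
    rw [Matrix.mul_smul]
    exact h4
  have h5 := congrArg (fun A => E⁻¹ * A) h3
  simpa [← Matrix.mul_assoc, Matrix.nonsing_inv_mul _ hdet] using h5

/-! ### Local isometries through a common model -/

/-- A smooth map pulling a tensor `h` back to a nondegenerate tensor `g` near `p` restricts to a
diffeomorphism from a neighbourhood of `p` onto an open set. -/
theorem exists_chart {g h : Tensor2} {M : Set Coord} (hM : IsOpen M)
    (hg : ∀ x ∈ M, ∀ v, (∀ w, bil g x v w = 0) → v = 0) {F : Coord → Coord}
    (hF : ContDiff ℝ ∞ F) {p : Coord} (hp : p ∈ M)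
    (hiso : ∀ᶠ x in 𝓝 p, ∀ v w, bil h (F x) (fderiv ℝ F x v) (fderiv ℝ F x w) = bil g x v w) :
    ∃ A : OpenPartialHomeomorph Coord Coord, p ∈ A.source ∧ A.source ⊆ M ∧ (A : Coord → Coord) = F ∧
      ContDiffOn ℝ ∞ A.symm A.target ∧ ∀ x ∈ A.source, ∀ v w,
        bil h (F x) (fderiv ℝ F x v) (fderiv ℝ F x w) = bil g x v w := by
  have hequiv : ∀ x ∈ M, (∀ v w, bil h (F x) (fderiv ℝ F x v) (fderiv ℝ F x w) = bil g x v w) →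
      ∃ L : Coord ≃L[ℝ] Coord, HasFDerivAt F (L : Coord →L[ℝ] Coord) x := by
    intro x hx hi
    -- A vector killed by dF is g-orthogonal to everything, hence zero. Injectivity is bijectivity
    -- in finite dimension.
    have hinj : Function.Injective (fderiv ℝ F x).toLinearMap := by
      rw [← LinearMap.ker_eq_bot, LinearMap.ker_eq_bot']
      intro v hv
      have hv' : fderiv ℝ F x v = 0 := hv
      refine hg x hx v fun w => ?_
      rw [← hi v w, hv']
      simp [bil]
    refine ⟨(LinearEquiv.ofInjectiveEndo _ hinj).toContinuousLinearEquiv, ?_⟩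
    exact (hF.differentiable (by simp) x).hasFDerivAt.congr_fderiv (by ext; rfl)
  obtain ⟨S, hS, hSo, hpS⟩ := eventually_nhds_iff.1 hiso
  obtain ⟨L, hL⟩ := hequiv p hp (hS p hpS)
  let A₀ := hF.contDiffAt.toOpenPartialHomeomorph F hL (by simp)
  have hA₀ : (A₀ : Coord → Coord) = F := rfl
  let A := A₀.restrOpen (M ∩ S) (hM.inter hSo)
  have hA : (A : Coord → Coord) = F := rfl
  have hAs : A.source = A₀.source ∩ (M ∩ S) := A₀.restrOpen_source _ _
  refine ⟨A, ?_, ?_, hA, ?_, ?_⟩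
  · rw [hAs]
    exact ⟨hF.contDiffAt.mem_toOpenPartialHomeomorph_source hL (by simp), hp, hpS⟩
  · rw [hAs]
    exact fun x hx => hx.2.1
  · intro y hy
    have hx : A.symm y ∈ A.source := A.map_target hy
    rw [hAs] at hx
    obtain ⟨L', hL'⟩ := hequiv _ hx.2.1 (hS _ hx.2.2)
    exact (A.contDiffAt_symm hy (hA ▸ hL') (hA ▸ hF.contDiffAt)).contDiffWithinAt
  · intro x hx
    rw [hAs] at hx
    exact hS x hx.2.2

/-- Two points near which `(M, g)` has smooth maps to a common model, sending them to the same
point and pulling the model tensor back to `g`, are related by a local isometry. -/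
theorem exists_isLocalIsometry {g h : Tensor2} {M : Set Coord} (hM : IsOpen M)
    (hg : ∀ x ∈ M, ∀ v, (∀ w, bil g x v w = 0) → v = 0) {F G : Coord → Coord}
    (hF : ContDiff ℝ ∞ F) (hG : ContDiff ℝ ∞ G) {p q : Coord} (hp : p ∈ M) (hq : q ∈ M)
    (hFiso : ∀ᶠ x in 𝓝 p, ∀ v w, bil h (F x) (fderiv ℝ F x v) (fderiv ℝ F x w) = bil g x v w)
    (hGiso : ∀ᶠ x in 𝓝 q, ∀ v w, bil h (G x) (fderiv ℝ G x v) (fderiv ℝ G x w) = bil g x v w)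
    (hpq : F p = G q) :
    ∃ f : OpenPartialHomeomorph Coord Coord, IsLocalIsometry g M f ∧ p ∈ f.source ∧ f p = q := by
  obtain ⟨A, hpA, hAM, rfl, hAs, hAi⟩ := exists_chart hM hg hF hp hFiso
  obtain ⟨B, hqB, hBM, rfl, hBs, hBi⟩ := exists_chart hM hg hG hq hGiso
  have hsrc : ∀ x, x ∈ (A.trans B.symm).source ↔ x ∈ A.source ∧ A x ∈ B.target := by
    intro x; simp
  have htgt : ∀ x, x ∈ (A.trans B.symm).target ↔ x ∈ B.source ∧ B x ∈ A.target := by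
    intro x; simp
  have hsm : ContDiffOn ℝ ∞ (A.trans B.symm) (A.trans B.symm).source := by
    rw [OpenPartialHomeomorph.coe_trans]
    exact hBs.comp hF.contDiffOn fun x hx => ((hsrc x).1 hx).2
  refine ⟨A.trans B.symm, ⟨?_, ?_, hsm, ?_, ?_⟩, ?_, ?_⟩
  · exact fun x hx => hAM ((hsrc x).1 hx).1
  · exact fun x hx => hBM ((htgt x).1 hx).1
  · rw [OpenPartialHomeomorph.trans_symm_eq_symm_trans_symm, OpenPartialHomeomorph.coe_trans]
    exact hAs.comp hG.contDiffOn fun x hx => ((htgt x).1 hx).2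
  · intro x hx v w
    have hxA := ((hsrc x).1 hx).1
    have hyB : (A.trans B.symm) x ∈ B.source := ((htgt _).1 ((A.trans B.symm).map_source hx)).1
    have hBf : ∀ y ∈ (A.trans B.symm).source, B ((A.trans B.symm) y) = A y := fun y hy =>
      B.right_inv ((hsrc y).1 hy).2
    have hd : DifferentiableAt ℝ (A.trans B.symm) x :=
      (hsm.contDiffAt ((A.trans B.symm).open_source.mem_nhds hx)).differentiableAt (by simp)
    have hev : (fun y => B ((A.trans B.symm) y)) =ᶠ[𝓝 x] A := by
      filter_upwards [(A.trans B.symm).open_source.mem_nhds hx] with y hy using hBf y hy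
    -- Differentiating B ∘ f = A gives dB ∘ df = dA; as `A` and `B` both pull `h` back to `g`, `f`
    -- preserves `g`.
    have hfd : (fderiv ℝ B ((A.trans B.symm) x)).comp (fderiv ℝ (A.trans B.symm) x) =
        fderiv ℝ A x := by
      rw [← hev.fderiv_eq]
      exact (fderiv_comp x (hG.differentiable (by simp) _) hd).symm
    rw [← hAi x hxA, ← hBi _ hyB, hBf x hx, ← hfd]
    rfl
  · rw [hsrc]
    exact ⟨hpA, hpq ▸ B.map_source hqB⟩
  · simp [hpq, B.left_inv hqB]

/-! ### Tools for explicit charts -/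

/-- The bilinear form of the Gödel-like metric. -/
theorem bil_metric (D H : ℝ → ℝ) (x v w : Coord) : bil (metric D H) x v w =
    -((v 0 + H (x 1) * v 2) * (w 0 + H (x 1) * w 2)) + D (x 1) ^ 2 * (v 2 * w 2) + v 1 * w 1 := by
  simp [bil, metric, Fin.sum_univ_three]
  ring

theorem metric_nondegenerate {D H : ℝ → ℝ} {x : Coord} (h0 : D (x 1) ≠ 0) (v : Coord)
    (hv : ∀ w, bil (metric D H) x v w = 0) : v = 0 := by
  -- The test vectors are ∂_r, ∂_t and ∂_φ - H ∂_t; the last is annihilated by dt + H dφ, so it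
  -- isolates D² v₂.
  have h1 := hv ![0, 1, 0]
  have h2 := hv ![1, 0, 0]
  have h3 := hv ![-H (x 1), 0, 1]
  simp [bil_metric] at h1 h2 h3
  have h4 : v 2 = 0 := by tauto
  ext i
  fin_cases i
  · simp [h4] at h2; simpa using h2
  · simpa using h1
  · simpa using h4

/-- The derivative of a map along `v` can be computed on the line in direction `v`. -/
theorem fderiv_apply_of_line {F : Coord → Coord} {x v u : Coord} (hF : DifferentiableAt ℝ F x)
    (h : ∀ i, HasDerivAt (fun s : ℝ => F (x + s • v) i) (u i) 0) : fderiv ℝ F x v = u := by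
  have h1 : HasDerivAt (fun s : ℝ => x + s • v) v 0 := by
    simpa using ((hasDerivAt_id (0 : ℝ)).smul_const v).const_add x
  have h2 : HasFDerivAt F (fderiv ℝ F x) (x + (0 : ℝ) • v) := by simpa using hF.hasFDerivAt
  exact (h2.comp_hasDerivAt (0 : ℝ) h1).unique (hasDerivAt_pi.2 h)

/-- The generalized cosine and sine. -/
theorem exists_cosine_sine (k : ℝ) : ∃ c s : ℝ → ℝ, ContDiff ℝ ∞ c ∧ ContDiff ℝ ∞ s ∧
    (∀ x, HasDerivAt c (k * s x) x) ∧ (∀ x, HasDerivAt s (c x) x) ∧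
    c 0 = 1 ∧ s 0 = 0 ∧ ∀ x, c x ^ 2 - k * s x ^ 2 = 1 := by
  have hlin : ∀ m x : ℝ, HasDerivAt (fun y => m * y) m x := fun m x => by
    simpa using (hasDerivAt_id x).const_mul m
  rcases lt_trichotomy k 0 with hk | rfl | hk
  · obtain ⟨m, hm, rfl⟩ : ∃ m : ℝ, m ≠ 0 ∧ k = -m ^ 2 :=
      ⟨√(-k), (Real.sqrt_pos.2 (by linarith)).ne', by rw [Real.sq_sqrt (by linarith)]; ring⟩
    refine ⟨fun x => Real.cos (m * x), fun x => Real.sin (m * x) / m, by fun_prop, by fun_prop,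
      fun x => ?_, fun x => ?_, by simp, by simp, fun x => ?_⟩
    · exact (hlin m x).cos.congr_deriv (by field_simp)
    · exact ((hlin m x).sin.div_const m).congr_deriv (by field_simp)
    · have := Real.sin_sq_add_cos_sq (m * x)
      field_simp
      linarith
  · exact ⟨fun _ => 1, fun x => x, contDiff_const, contDiff_id,
      fun x => by simpa using hasDerivAt_const x (1 : ℝ), fun x => hasDerivAt_id x, rfl, rfl,
      fun x => by simp⟩
  · obtain ⟨m, hm, rfl⟩ : ∃ m : ℝ, m ≠ 0 ∧ k = m ^ 2 :=
      ⟨√k, (Real.sqrt_pos.2 hk).ne', by rw [Real.sq_sqrt hk.le]⟩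
    refine ⟨fun x => Real.cosh (m * x), fun x => Real.sinh (m * x) / m,
      by fun_prop, by fun_prop,
      fun x => ?_, fun x => ?_, by simp, by simp, fun x => ?_⟩
    · exact (hlin m x).cosh.congr_deriv (by field_simp)
    · exact ((hlin m x).sinh.div_const m).congr_deriv (by field_simp)
    · have := Real.cosh_sq (m * x)
      field_simp
      linarith

/-- The functions `(cos (b x) - 1) / b` and `sin (b x) / b`, with their limits for `b = 0`. -/
theorem exists_versine_sine (b : ℝ) : ∃ e s : ℝ → ℝ, ContDiff ℝ ∞ e ∧ ContDiff ℝ ∞ s ∧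
    (∀ x, HasDerivAt e (-b * s x) x) ∧ (∀ x, HasDerivAt s (1 + b * e x) x) ∧
    e 0 = 0 ∧ s 0 = 0 ∧ ∀ x, (1 + b * e x) ^ 2 + b ^ 2 * s x ^ 2 = 1 := by
  obtain ⟨c, s, hc, hs, hc', hs', hc0, hs0, h1⟩ := exists_cosine_sine (-b ^ 2)
  rcases eq_or_ne b 0 with rfl | hb
  · exact ⟨fun _ => 0, fun x => x, contDiff_const, contDiff_id,
      fun x => by simpa using hasDerivAt_const x (0 : ℝ), fun x => by simpa using hasDerivAt_id' x,
      rfl, rfl, fun x => by simp⟩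
  · have he : ∀ x, 1 + b * ((c x - 1) / b) = c x := fun x => by field_simp; ring
    refine ⟨fun x => (c x - 1) / b, s, by fun_prop, hs, fun x => ?_, fun x => ?_, by simp [hc0],
      hs0, fun x => ?_⟩
    · exact (((hc' x).sub_const 1).div_const b).congr_deriv (by field_simp)
    · rw [he]; exact hs' x
    · rw [he]; linarith [h1 x]

theorem hasDerivAt_line (x v : Coord) (i : Fin 3) :
    HasDerivAt (fun s : ℝ => (x + s • v) i) (v i) 0 := by
  simpa using ((hasDerivAt_id (0 : ℝ)).mul_const (v i)).const_add (x i)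

/-! ### The flat model, for k = 0 -/

/-- The Minkowski metric. -/
def minkowski : Tensor2 := fun _ => Matrix.diagonal ![-1, 1, 1]

/-- Minkowskian coordinates around `p` for affine `D` and constant `H`. -/
theorem exists_flat_chart {I : Set ℝ} {D H : ℝ → ℝ} {p : Coord} {d b c₀ : ℝ}
    (hD : ∀ r ∈ I, D r = d + b * (r - p 1)) (hH : ∀ r ∈ I, H r = c₀) :
    ∃ F : Coord → Coord, ContDiff ℝ ∞ F ∧ F p = 0 ∧ ∀ x ∈ domain I, ∀ v w,
      bil minkowski (F x) (fderiv ℝ F x v) (fderiv ℝ F x w) = bil (metric D H) x v w := by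
  obtain ⟨e, s, he, hs, he', hs', he0, hs0, h1⟩ := exists_versine_sine b
  -- For b ≠ 0 the last two entries are D sin(bφ)/b and (D cos(bφ) - d)/b, with φ measured from p:
  -- polar coordinates of radius D/b and angle bφ, shifted to send p to 0. In terms of `e` and `s`
  -- the formula also covers b = 0.
  let F : Coord → Coord := fun x => ![(x 0 - p 0) + c₀ * (x 2 - p 2),
    (d + b * (x 1 - p 1)) * s (x 2 - p 2), (d + b * (x 1 - p 1)) * e (x 2 - p 2) + (x 1 - p 1)]
  have hF : ContDiff ℝ ∞ F := by
    rw [contDiff_pi]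
    intro i
    fin_cases i <;> simp only [F, Fin.zero_eta, Fin.mk_one, Fin.reduceFinMk,
      Matrix.cons_val_zero, Matrix.cons_val_one, Matrix.cons_val] <;> fun_prop
  have hFd : ∀ x v : Coord, fderiv ℝ F x v = ![v 0 + c₀ * v 2,
      b * v 1 * s (x 2 - p 2) + (d + b * (x 1 - p 1)) * ((1 + b * e (x 2 - p 2)) * v 2),
      b * v 1 * e (x 2 - p 2) + (d + b * (x 1 - p 1)) * (-b * s (x 2 - p 2) * v 2) + v 1] := by
    intro x v
    refine fderiv_apply_of_line (hF.differentiable (by simp) x) fun i => ?_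
    have h0 := (hasDerivAt_line x v 0).sub_const (p 0)
    have h1 := (hasDerivAt_line x v 1).sub_const (p 1)
    have h2 := (hasDerivAt_line x v 2).sub_const (p 2)
    have h3 := (h1.const_mul b).const_add d
    have h4 := (hs' _).comp (0 : ℝ) h2
    have h5 := (he' _).comp (0 : ℝ) h2
    have h6 := h3.fun_mul h4
    have h7 := (h3.fun_mul h5).fun_add h1
    simp only [Function.comp_apply, zero_smul, add_zero] at h6 h7
    fin_cases i
    · exact h0.fun_add (h2.const_mul c₀)
    · exact h6
    · exact h7
  refine ⟨F, hF, ?_, fun x hx v w => ?_⟩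
  · ext i
    fin_cases i <;> simp [F, he0, hs0]
  · rw [bil_metric, hFd, hFd, hD _ hx, hH _ hx]
    simp only [bil, minkowski, Fin.sum_univ_three, Matrix.diagonal_apply]
    simp
    linear_combination (v 1 * w 1 + (d + b * (x 1 - p 1)) ^ 2 * v 2 * w 2) * h1 (x 2 - p 2)

/-! ### The model SL₂(ℝ), for k ≠ 0 -/

/-- The bi-invariant metric `-(4 / k²) det(dX)` of `SL₂(ℝ)`, in the coordinates given by the
entries `X 0, X 1, X 2` of the matrix `!![X 0, X 1; X 2, (1 + X 1 * X 2) / X 0]`. -/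
noncomputable def slMetric (k : ℝ) : Tensor2 := fun X =>
  (4 / k ^ 2) • !![(1 + X 1 * X 2) / X 0 ^ 2, -X 2 / (2 * X 0), -X 1 / (2 * X 0);
    -X 2 / (2 * X 0), 0, 1 / 2; -X 1 / (2 * X 0), 1 / 2, 0]

/-- With the fourth matrix entry restored, the metric is the polarized determinant, free of
denominators in X. The hypotheses on `v₃` and `w₃` are tangency to det X = 1, which determines them.
-/
theorem bil_slMetric {k : ℝ} {X v w : Coord} {X₃ v₃ w₃ : ℝ} (hX : X 0 ≠ 0)
    (h : X 0 * X₃ - X 1 * X 2 = 1)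
    (hv : X 0 * v₃ + X₃ * v 0 - X 1 * v 2 - X 2 * v 1 = 0)
    (hw : X 0 * w₃ + X₃ * w 0 - X 1 * w 2 - X 2 * w 1 = 0) :
    bil (slMetric k) X v w =
      -(2 / k ^ 2) * (v 0 * w₃ + v₃ * w 0 - v 1 * w 2 - v 2 * w 1) := by
  obtain rfl : X₃ = (1 + X 1 * X 2) / X 0 := by field_simp; linarith
  obtain rfl : v₃ = (X 1 * v 2 + X 2 * v 1 - (1 + X 1 * X 2) / X 0 * v 0) / X 0 := by
    field_simp at hv ⊢; linarith
  obtain rfl : w₃ = (X 1 * w 2 + X 2 * w 1 - (1 + X 1 * X 2) / X 0 * w 0) / X 0 := by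
    field_simp at hw ⊢; linarith
  simp only [bil, slMetric, Fin.sum_univ_three]
  simp
  field_simp
  ring

/-- Coordinates around `p` in which the Gödel-like metric with constant `H' / D = k ≠ 0` and
`D'' = k² D` is the bi-invariant metric of `SL₂(ℝ)`. -/
theorem exists_sl_chart {I : Set ℝ} (hI : IsOpen I) {D H : ℝ → ℝ} {p : Coord} (hp : p ∈ domain I)
    {k a b c₀ : ℝ} (hk : k ≠ 0)
    (hD : ∀ r ∈ I, D r = a * Real.exp (k * (r - p 1)) + b * Real.exp (-(k * (r - p 1))))
    (hH : ∀ r ∈ I, H r = a * Real.exp (k * (r - p 1)) - b * Real.exp (-(k * (r - p 1))) + c₀) :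
    ∃ F : Coord → Coord, ContDiff ℝ ∞ F ∧ F p = ![1, 0, 0] ∧ ∀ᶠ x in 𝓝 p, ∀ v w,
      bil (slMetric k) (F x) (fderiv ℝ F x v) (fderiv ℝ F x w) = bil (metric D H) x v w := by
  -- The matrix N = k !![0, b; a, 0] has N² = k²ab, so exp(φN) = c(φ) + s(φ) N for these functions.
  obtain ⟨c, s, hc, hs, hc', hs', hc0, hs0, hcs⟩ := exists_cosine_sine (k ^ 2 * a * b)
  let c' : Coord → ℝ := fun x => c (x 2 - p 2)
  let s' : Coord → ℝ := fun x => s (x 2 - p 2)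
  let u : Coord → ℝ := fun x => Real.exp (k / 2 * (x 1 - p 1))
  let ui : Coord → ℝ := fun x => Real.exp (-(k / 2 * (x 1 - p 1)))
  let C : Coord → ℝ := fun x => Real.cos (k / 2 * ((x 0 - p 0) + c₀ * (x 2 - p 2)))
  let S : Coord → ℝ := fun x => Real.sin (k / 2 * ((x 0 - p 0) + c₀ * (x 2 - p 2)))
  -- Three entries of the product exp(φN) · diag(u, u⁻¹) · (rotation by k(t + c₀φ)/2), coordinates
  -- measured from p. The shift c₀φ absorbs the constant in H. The fourth entry is `F₃` below.
  let F : Coord → Coord := fun x =>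
    ![c' x * u x * C x + k * b * s' x * ui x * S x,
      k * b * s' x * ui x * C x - c' x * u x * S x,
      k * a * s' x * u x * C x + c' x * ui x * S x]
  have hF : ContDiff ℝ ∞ F := by
    rw [contDiff_pi]
    intro i
    fin_cases i <;> simp only [F, c', s', u, ui, C, S, Fin.zero_eta, Fin.mk_one, Fin.reduceFinMk,
      Matrix.cons_val_zero, Matrix.cons_val_one, Matrix.cons_val] <;> fun_prop
  let dc : Coord → Coord → ℝ := fun x v => k ^ 2 * a * b * s' x * v 2
  let ds : Coord → Coord → ℝ := fun x v => c' x * v 2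
  let du : Coord → Coord → ℝ := fun x v => u x * (k / 2 * v 1)
  let dui : Coord → Coord → ℝ := fun x v => ui x * (-(k / 2 * v 1))
  let dC : Coord → Coord → ℝ := fun x v => -S x * (k / 2 * (v 0 + c₀ * v 2))
  let dS : Coord → Coord → ℝ := fun x v => C x * (k / 2 * (v 0 + c₀ * v 2))
  have hFd : ∀ x v : Coord, fderiv ℝ F x v =
      ![(dc x v * u x + c' x * du x v) * C x + c' x * u x * dC x v
          + (k * b * (ds x v * ui x + s' x * dui x v) * S x + k * b * s' x * ui x * dS x v),
        (k * b * (ds x v * ui x + s' x * dui x v) * C x + k * b * s' x * ui x * dC x v)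
          - ((dc x v * u x + c' x * du x v) * S x + c' x * u x * dS x v),
        (k * a * (ds x v * u x + s' x * du x v) * C x + k * a * s' x * u x * dC x v)
          + ((dc x v * ui x + c' x * dui x v) * S x + c' x * ui x * dS x v)] := by
    intro x v
    refine fderiv_apply_of_line (hF.differentiable (by simp) x) fun i => ?_
    have h0 := (hasDerivAt_line x v 0).sub_const (p 0)
    have h1 := ((hasDerivAt_line x v 1).sub_const (p 1)).const_mul (k / 2)
    have h2 := (hasDerivAt_line x v 2).sub_const (p 2)
    have h3 := (h0.fun_add (h2.const_mul c₀)).const_mul (k / 2)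
    have hc := (hc' _).comp (0 : ℝ) h2
    have hs := (hs' _).comp (0 : ℝ) h2
    have hu := h1.exp
    have hui := h1.fun_neg.exp
    have hC := h3.cos
    have hS := h3.sin
    fin_cases i
    · refine (((hc.fun_mul hu).fun_mul hC).fun_add
        (((hs.const_mul (k * b)).fun_mul hui).fun_mul hS)).congr_deriv ?_
      simp only [dc, ds, du, dui, dC, dS, c', s', u, ui, C, S, Fin.zero_eta, Matrix.cons_val_zero,
        Function.comp_apply, zero_smul, add_zero]
      ring
    · refine ((((hs.const_mul (k * b)).fun_mul hui).fun_mul hC).fun_sub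
        ((hc.fun_mul hu).fun_mul hS)).congr_deriv ?_
      simp only [dc, ds, du, dui, dC, dS, c', s', u, ui, C, S, Fin.mk_one, Matrix.cons_val_one, Matrix.cons_val_zero,
        Function.comp_apply, zero_smul, add_zero]
      ring
    · refine ((((hs.const_mul (k * a)).fun_mul hu).fun_mul hC).fun_add
        ((hc.fun_mul hui).fun_mul hS)).congr_deriv ?_
      simp only [dc, ds, du, dui, dC, dS, c', s', u, ui, C, S, Fin.reduceFinMk, Matrix.cons_val,
        Function.comp_apply, zero_smul, add_zero]
      ring
  have hFp : F p = ![1, 0, 0] := by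
    ext i
    fin_cases i <;> simp [F, c', s', u, ui, C, S, hc0, hs0]
  have hne : ∀ᶠ x in 𝓝 p, F x 0 ≠ 0 :=
    ((continuous_apply (0 : Fin 3)).comp hF.continuous).continuousAt.eventually_ne
      (by simp [hFp])
  refine ⟨F, hF, hFp, ?_⟩
  filter_upwards [hne, (isOpen_domain hI).mem_nhds hp] with x hx0 hx v w
  have hcs1 : c' x ^ 2 - k ^ 2 * a * b * s' x ^ 2 = 1 := hcs _
  have hCS1 : C x ^ 2 + S x ^ 2 = 1 := Real.cos_sq_add_sin_sq _
  have hu1 : u x * ui x = 1 := by simp [u, ui, ← Real.exp_add]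
  have hDx : D (x 1) = a * u x ^ 2 + b * ui x ^ 2 := by
    rw [hD _ hx]; simp only [u, ui, ← Real.exp_nat_mul]; push_cast; ring_nf
  have hHx : H (x 1) = a * u x ^ 2 - b * ui x ^ 2 + c₀ := by
    rw [hH _ hx]; simp only [u, ui, ← Real.exp_nat_mul]; push_cast; ring_nf
  let F₃ : ℝ := c' x * ui x * C x - k * a * s' x * u x * S x
  let dF₃ : Coord → ℝ := fun v =>
    ((dc x v * ui x + c' x * dui x v) * C x + c' x * ui x * dC x v)
      - (k * a * (ds x v * u x + s' x * du x v) * S x + k * a * s' x * u x * dS x v)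
  have hdet : F x 0 * F₃ - F x 1 * F x 2 = 1 := by
    have h1 : F x 0 * F₃ - F x 1 * F x 2 = (u x * ui x) *
        (c' x ^ 2 - k ^ 2 * a * b * s' x ^ 2) * (C x ^ 2 + S x ^ 2) := by
      simp [F, F₃]
      ring
    rw [h1, hu1, hcs1, hCS1]
    norm_num
  have hd : ∀ v : Coord, F x 0 * dF₃ v + F₃ * fderiv ℝ F x v 0
      - F x 1 * fderiv ℝ F x v 2 - F x 2 * fderiv ℝ F x v 1 = 0 := by
    intro v
    rw [hFd]
    simp [F, F₃, dF₃, dc, ds, du, dui, dC, dS]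
    ring
  rw [bil_slMetric hx0 hdet (hd v) (hd w), bil_metric, hDx, hHx]
  -- The factors c² - k²ab s², C² + S² and u · ui, all equal to 1, are split off so that they can be
  -- replaced.
  have hpol : fderiv ℝ F x v 0 * dF₃ w + dF₃ v * fderiv ℝ F x w 0
      - fderiv ℝ F x v 1 * fderiv ℝ F x w 2 - fderiv ℝ F x v 2 * fderiv ℝ F x w 1 =
      (c' x ^ 2 - k ^ 2 * a * b * s' x ^ 2) * (C x ^ 2 + S x ^ 2) * (-(k ^ 2 / 2) *
        ((u x * ui x) * (v 1 * w 1 + 4 * a * b * (v 2 * w 2)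
          - (v 0 + c₀ * v 2) * (w 0 + c₀ * w 2))
        + (b * ui x ^ 2 - a * u x ^ 2) *
          (v 2 * (w 0 + c₀ * w 2) + w 2 * (v 0 + c₀ * v 2)))) := by
    rw [hFd, hFd]
    simp [dF₃, dc, ds, du, dui, dC, dS]
    ring
  rw [hpol, hcs1, hCS1, hu1]
  field_simp
  -- What remains is D² - (H - c₀)² = 4ab (u · ui)², compared with 4ab.
  linear_combination (-(4 * a * b * v 2 * w 2) * (1 + u x * ui x)) * hu1

/-! ### Integration of the field equations and local homogeneity -/

theorem exists_eqOn_const {I : Set ℝ} (hI : IsOpen I) (hc : IsPreconnected I) {f : ℝ → ℝ}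
    (hf : ∀ r ∈ I, HasDerivAt f 0 r) : ∃ a, ∀ r ∈ I, f r = a :=
  hI.exists_is_const_of_deriv_eq_zero hc
    (fun r hr => (hf r hr).differentiableAt.differentiableWithinAt) fun r hr => (hf r hr).deriv

namespace Profile

variable {I : Set ℝ} {D D' D'' H H' H'' : ℝ → ℝ}

/-- The field equations expressed by P-type O. -/
theorem field_equations (P : Profile I D D' D'' H H' H'') (hO : IsPTypeO (metric D H) (domain I))
    {x : Coord} (hx : x ∈ domain I) :
    ricci (metric D H) x = (-(H' (x 1) ^ 2 / (2 * D (x 1) ^ 2))) • metric D H x ∧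
      D'' (x 1) * D (x 1) = H' (x 1) ^ 2 ∧ H'' (x 1) * D (x 1) = H' (x 1) * D' (x 1) := by
  have h0 := P.ne_zero _ hx
  obtain ⟨lam, h⟩ := (hO x hx).exists_smul
  have h00 := P.ricci_zero_zero hx
  have h11 := P.ricci_one_one hx
  have h02 := P.ricci_zero_two hx
  rw [h] at h00 h11 h02
  simp only [metric, Matrix.smul_apply, smul_eq_mul] at h00 h11 h02
  simp at h00 h11 h02
  have hlam : lam = -(H' (x 1) ^ 2 / (2 * D (x 1) ^ 2)) := by linarith
  refine ⟨by rw [h, hlam], ?_, ?_⟩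
  · rw [hlam] at h11
    field_simp at h11
    linarith
  · rw [hlam] at h02
    field_simp at h02
    exact mul_left_cancel₀ h0 (by linarith)

theorem exists_rotation (P : Profile I D D' D'' H H' H'') (hc : IsPreconnected I)
    (hO : IsPTypeO (metric D H) (domain I)) :
    ∃ k : ℝ, ∀ r ∈ I, H' r = k * D r ∧ D'' r = k ^ 2 * D r := by
  -- The equations involve r only, so any point with this r-coordinate serves; here it is (r, r, r).
  have heq := fun r (hr : r ∈ I) => P.field_equations hO (x := fun _ => r) hr
  obtain ⟨k, hk⟩ := exists_eqOn_const (f := fun r => H' r / D r) P.isOpen hc fun r hr => by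
    refine ((P.hasDerivAt_H' r hr).fun_div (P.hasDerivAt_D r hr) (P.ne_zero r hr)).congr_deriv ?_
    rw [(heq r hr).2.2, sub_self, zero_div]
  refine ⟨k, fun r hr => ?_⟩
  have h0 := P.ne_zero r hr
  have h1 : H' r = k * D r := (div_eq_iff h0).1 (hk r hr)
  refine ⟨h1, mul_right_cancel₀ h0 ?_⟩
  rw [(heq r hr).2.1, h1]
  ring

theorem exists_affine (P : Profile I D D' D'' H H' H'') (hc : IsPreconnected I)
    (hH : ∀ r ∈ I, H' r = 0) (hD : ∀ r ∈ I, D'' r = 0) {r₀ : ℝ} :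
    ∃ d b c₀ : ℝ, (∀ r ∈ I, D r = d + b * (r - r₀)) ∧ ∀ r ∈ I, H r = c₀ := by
  obtain ⟨b, hb⟩ := exists_eqOn_const P.isOpen hc fun r hr => hD r hr ▸ P.hasDerivAt_D' r hr
  obtain ⟨c₀, hc₀⟩ := exists_eqOn_const P.isOpen hc fun r hr => hH r hr ▸ P.hasDerivAt_H r hr
  obtain ⟨d, hd⟩ := exists_eqOn_const (f := fun r => D r - b * (r - r₀)) P.isOpen hc fun r hr =>
    ((P.hasDerivAt_D r hr).fun_sub
      (((hasDerivAt_id' r).sub_const r₀).const_mul b)).congr_deriv (by rw [hb r hr]; ring)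
  exact ⟨d, b, c₀, fun r hr => by linarith [hd r hr], hc₀⟩

/-- D'' = k²D factors into first-order equations: D' ± kD has derivative ±k(D' ± kD), so it is a
multiple of exp(±k(r - r₀)). Also H - D'/k is constant, because H' = kD = D''/k. -/
theorem exists_exponential (P : Profile I D D' D'' H H' H'') (hc : IsPreconnected I) {k : ℝ}
    (hk : k ≠ 0) (hH : ∀ r ∈ I, H' r = k * D r) (hD : ∀ r ∈ I, D'' r = k ^ 2 * D r) (r₀ : ℝ) :
    ∃ a b c₀ : ℝ,
      (∀ r ∈ I, D r = a * Real.exp (k * (r - r₀)) + b * Real.exp (-(k * (r - r₀)))) ∧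
      ∀ r ∈ I, H r = a * Real.exp (k * (r - r₀)) - b * Real.exp (-(k * (r - r₀))) + c₀ := by
  have hlin : ∀ r, HasDerivAt (fun r => k * (r - r₀)) k r := fun r => by
    simpa using ((hasDerivAt_id' r).sub_const r₀).const_mul k
  obtain ⟨A, hA⟩ := exists_eqOn_const
    (f := fun r => (D' r + k * D r) * Real.exp (-(k * (r - r₀)))) P.isOpen hc fun r hr =>
    (((P.hasDerivAt_D' r hr).fun_add ((P.hasDerivAt_D r hr).const_mul k)).fun_mul
      (hlin r).fun_neg.exp).congr_deriv (by rw [hD r hr]; ring)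
  obtain ⟨B, hB⟩ := exists_eqOn_const
    (f := fun r => (D' r - k * D r) * Real.exp (k * (r - r₀))) P.isOpen hc fun r hr =>
    (((P.hasDerivAt_D' r hr).fun_sub ((P.hasDerivAt_D r hr).const_mul k)).fun_mul
      (hlin r).exp).congr_deriv (by rw [hD r hr]; ring)
  obtain ⟨c₀, hc₀⟩ := exists_eqOn_const (f := fun r => H r - D' r / k) P.isOpen hc fun r hr =>
    ((P.hasDerivAt_H r hr).fun_sub ((P.hasDerivAt_D' r hr).div_const k)).congr_deriv
      (by rw [hD r hr, hH r hr]; field_simp; ring)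
  have hsol : ∀ r ∈ I, D' r + k * D r = A * Real.exp (k * (r - r₀)) ∧
      D' r - k * D r = B * Real.exp (-(k * (r - r₀))) := by
    intro r hr
    rw [← hA r hr, ← hB r hr, mul_assoc, mul_assoc, ← Real.exp_add, ← Real.exp_add]
    simp
  refine ⟨A / (2 * k), -B / (2 * k), c₀, fun r hr => ?_, fun r hr => ?_⟩
  · obtain ⟨h1, h2⟩ := hsol r hr
    field_simp
    linarith
  · obtain ⟨h1, h2⟩ := hsol r hr
    have h3 := hc₀ r hr
    field_simp at h3 ⊢
    linarith

/-- The constants a, b, c₀, d of the charts may differ at p and q, but model and base point do not,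
so the two charts can be composed. -/
theorem isLocallyHomogeneous (P : Profile I D D' D'' H H' H'') (hc : IsPreconnected I) {k : ℝ}
    (hk : ∀ r ∈ I, H' r = k * D r ∧ D'' r = k ^ 2 * D r) :
    IsLocallyHomogeneous (metric D H) (domain I) := by
  intro p hp q hq
  have hM := isOpen_domain P.isOpen
  have hg : ∀ x ∈ domain I, ∀ v, (∀ w, bil (metric D H) x v w = 0) → v = 0 :=
    fun x hx v => metric_nondegenerate (P.ne_zero _ hx) v
  rcases eq_or_ne k 0 with rfl | hk0
  · have chart : ∀ p : Coord, ∃ F : Coord → Coord, ContDiff ℝ ∞ F ∧ F p = 0 ∧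
        ∀ x ∈ domain I, ∀ v w,
          bil minkowski (F x) (fderiv ℝ F x v) (fderiv ℝ F x w) = bil (metric D H) x v w := by
      intro p
      obtain ⟨d, b, c₀, h1, h2⟩ := P.exists_affine hc (fun r hr => by simp [(hk r hr).1])
        (fun r hr => by simp [(hk r hr).2]) (r₀ := p 1)
      exact exists_flat_chart h1 h2
    obtain ⟨F, hF, hFp, hFi⟩ := chart p
    obtain ⟨G, hG, hGq, hGi⟩ := chart q
    exact exists_isLocalIsometry hM hg hF hG hp hq
      (Filter.eventually_of_mem (hM.mem_nhds hp) hFi)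
      (Filter.eventually_of_mem (hM.mem_nhds hq) hGi) (hFp.trans hGq.symm)
  · have chart : ∀ p ∈ domain I, ∃ F : Coord → Coord, ContDiff ℝ ∞ F ∧ F p = ![1, 0, 0] ∧
        ∀ᶠ x in 𝓝 p, ∀ v w,
          bil (slMetric k) (F x) (fderiv ℝ F x v) (fderiv ℝ F x w) = bil (metric D H) x v w := by
      intro p hp
      obtain ⟨a, b, c₀, h1, h2⟩ := P.exists_exponential hc hk0 (fun r hr => (hk r hr).1)
        (fun r hr => (hk r hr).2) (p 1)
      exact exists_sl_chart P.isOpen hp hk0 h1 h2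
    obtain ⟨F, hF, hFp, hFi⟩ := chart p hp
    obtain ⟨G, hG, hGq, hGi⟩ := chart q hq
    exact exists_isLocalIsometry hM hg hF hG hp hq hFi hGi (hFp.trans hGq.symm)

end Profile

theorem hasDerivAt_of_contDiffOn {I : Set ℝ} (hI : IsOpen I) {f : ℝ → ℝ}
    (hf : ContDiffOn ℝ ∞ f I) : ∀ r ∈ I, HasDerivAt f (deriv f r) r := fun r hr =>
  ((hf.contDiffAt (hI.mem_nhds hr)).differentiableAt (by simp)).hasDerivAt

theorem profile_of_contDiffOn {I : Set ℝ} (hI : IsOpen I) {D H : ℝ → ℝ}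
    (hD : ContDiffOn ℝ ∞ D I) (hH : ContDiffOn ℝ ∞ H I) (hD0 : ∀ r ∈ I, D r ≠ 0) :
    Profile I D (deriv D) (deriv (deriv D)) H (deriv H) (deriv (deriv H)) where
  isOpen := hI
  hasDerivAt_D := hasDerivAt_of_contDiffOn hI hD
  hasDerivAt_D' := hasDerivAt_of_contDiffOn hI (hD.deriv_of_isOpen hI (by simp))
  hasDerivAt_H := hasDerivAt_of_contDiffOn hI hH
  hasDerivAt_H' := hasDerivAt_of_contDiffOn hI (hH.deriv_of_isOpen hI (by simp))
  ne_zero := hD0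

end GodelLike

theorem mainTheorem6 (I : Set ℝ) (hIopen : IsOpen I) (hIconn : I.OrdConnected)
    (D H : ℝ → ℝ) (hD : ContDiffOn ℝ ∞ D I) (hH : ContDiffOn ℝ ∞ H I)
    (hD0 : ∀ r ∈ I, D r ≠ 0)
    (hO : GodelLike.IsPTypeO (GodelLike.metric D H) (GodelLike.domain I)) :
    (∀ x ∈ GodelLike.domain I, ∀ c a b : Fin 3,
      GodelLike.covDeriv (GodelLike.metric D H) (GodelLike.ricci (GodelLike.metric D H))
        c a b x = 0) ∧
    GodelLike.IsLocallyHomogeneous (GodelLike.metric D H) (GodelLike.domain I) := by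
  have P := GodelLike.profile_of_contDiffOn hIopen hD hH hD0
  obtain ⟨k, hk⟩ := P.exists_rotation hIconn.isPreconnected hO
  -- Substituting H' = kD in λ = -H'²/(2D²) gives the constant -k²/2.
  refine ⟨fun x hx => P.covDeriv_const_smul hx (-(k ^ 2 / 2)) fun y hy => ?_,
    P.isLocallyHomogeneous hIconn.isPreconnected hk⟩
  have h0 := hD0 _ hy
  rw [(P.field_equations hO hy).1, (hk _ hy).1]
  congr 2
  field_simp
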